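/- **Definitions.** Let $\mathbf x\in A^{\mathbb N}$ be a sequence over an alphabet $A$ and let $k\ge 1$. Two finite words $u,v$ are $k$-abelian equivalent if every word $w$ of length at most $k$ occurs equally often as a factor in $u$ and in $v$; $\rho^k_{\mathbf x}(n)$ denotes the number of length-$n$ factors of $\mathbf x$ up to $k$-abelian equivalence. The length-$k$ sliding-block code $B_k(\mathbf x)$ is the sequence whose $i$th letter codes the factor $\mathbf x[i]\mathbf x[i+1]\cdots\mathbf x[i+k-1]$, where the distinct length-$k$ factors of $\mathbf x$ are mapped bijectively to the letters of a new alphabet $A_k$. The Parikh vector of a word $u$ over $A_k$ is $(|u|_a)_{a\in A_k}$, where $|u|_a$ is the number of occurrences of $a$ in $u$. An abstract numeration system (with zeros) $\mathcal N$ consists of a finite totally ordered alphabet $D$ with least element $0$ and a language $L\subseteq D^*$ such that $\varepsilon\in L$, such that $w\in L\Leftrightarrow 0w\in L$ for all $w\in D^*$, and such that $L\setminus 0^+L$ is infinite. For $n\in\mathbb N$, $\mathrm{rep}(n)$ is the $n$th element (counting from $0$) of $L\setminus 0^+L$ in radix order (words are compared first by length, then lexicographically), and for $u\in L$, $\mathrm{val}(u)$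 is the unique $n$ with $u\in 0^*\,\mathrm{rep}(n)$. A tuple $\langle u_1,\dots,u_r\rangle$ of words of equal length over $D$ is regarded as one word over $D^r$. The system $\mathcal N$ is regular if $L$ and $\{\langle u,v,w\rangle : u,v,w\in L,\ \mathrm{val}(u)+\mathrm{val}(v)=\mathrm{val}(w)\}$ are regular languages. A sequence $\mathbf y$ is $\mathcal N$-automatic if there is a deterministic finite automaton with output which, on input $u\in D^*$, has an output exactly when $u\in L$, this output then being $\mathbf y[\mathrm{val}(u)]$. A sequence $s:\mathbb N\to\mathbb N^m$ is $\mathcal N$-synchronized if $\{\langle u,v_1,\dots,v_m\rangle : u,v_1,\dots,v_m\in L,\ s(\mathrm{val}(u))=(\mathrm{val}(v_1),\dots,\mathrm{val}(v_m))\}$ is a regular language. A sequence $f:\mathbb N\to\mathbb C$ is $\mathcal N$-regular if there are $d\in\mathbb N$, a row vector $\lambda\in\mathbb C^{1\times d}$, a column vector $\gamma\in\mathbb C^{d\times 1}$ and a monoid morphism $\mu:D^*\to\mathbb C^{d\times d}$ such that $f(n)=\lambda\,\mu(\mathrm{rep}(n))\,\gamma$ for all $n\in\mathbb N$. **Theorem.**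 Let $k\ge 1$ be an integer and let $\mathbf x\in A^{\mathbb N}$ be a sequence such that $B_k(\mathbf x)$ is automatic in some regular numeration system $\mathcal N_k$. If the Parikh vectors of the length-$n$ prefixes of $B_k(\mathbf x)$, $n\ge 0$, form an $\mathcal N_k$-synchronized sequence, then $(\rho^k_{\mathbf x}(n))_{n\ge 0}$ is $\mathcal N_k$-regular. -/

import Mathlib

/-! ### Factors, generalized abelian complexity, sliding-block codes -/

/-- The length-`n` factor `x[i] x[i+1] ⋯ x[i+n-1]` of the sequence `x`. -/
def factorAt {A : Type*} (x : ℕ → A) (i n : ℕ) : List A :=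
  (List.range n).map fun j => x (i + j)

/-- The set of length-`n` factors of the sequence `x`. -/
def factors {A : Type*} (x : ℕ → A) (n : ℕ) : Set (List A) :=
  {w | ∃ i, w = factorAt x i n}

/-- `|u|_w`: the number of occurrences (as a factor) of the word `w` in the word `u`. -/
noncomputable def occurrences {A : Type*} (w u : List A) : ℕ :=
  {i : ℕ | i + w.length ≤ u.length ∧ (u.drop i).take w.length = w}.ncard

/-- `k`-abelian equivalence of finite words. -/
def KAbelianEquiv {A : Type*} (k : ℕ) (u v : List A) : Prop :=
  ∀ w : List A, w.length ≤ k → occurrences w u = occurrences w v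

/-- `k`-abelian equivalence restricted to the length-`n` factors of `x`. -/
def kAbelianSetoid {A : Type*} (x : ℕ → A) (k n : ℕ) : Setoid (factors x n) where
  r u v := KAbelianEquiv k (u : List A) (v : List A)
  iseqv :=
    { refl := fun _ _ _ => rfl
      symm := fun h w hw => (h w hw).symm
      trans := fun h₁ h₂ w hw => (h₁ w hw).trans (h₂ w hw) }

/-- The `k`-abelian complexity `ρ^k_x(n)`: the number of length-`n` factors of `x` up to
`k`-abelian equivalence. -/
noncomputable def kAbelianComplexity {A : Type*} (x : ℕ → A) (k n : ℕ) : ℕ :=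
  Nat.card (Quotient (kAbelianSetoid x k n))

/-- The length-`k` sliding-block code `B_k(x)` of `x`, where the bijection `θ` maps the distinct
length-`k` factors of `x` to the distinct letters of a new alphabet `C`. -/
def slidingBlockCode {A C : Type*} (x : ℕ → A) (k : ℕ) (θ : factors x k ≃ C) : ℕ → C :=
  fun i => θ ⟨factorAt x i k, i, rfl⟩

open Classical in
/-- The Parikh vector of a finite word. -/
noncomputable def parikh {C : Type*} (u : List C) : C → ℕ :=
  fun c => u.count c

/-- The sequence of Parikh vectors of the length-`n` prefixes of `y`. -/
noncomputable def prefixParikh {C : Type*} (y : ℕ → C) (n : ℕ) : C → ℕ :=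
  parikh (factorAt y 0 n)

/-! ### Abstract numeration systems with zeros -/

/-- The words of `L` that are not obtained from a word of `L` by adding a positive number of
leading zeros, i.e. `L \ 0⁺L`, where `0 = ⊥`. -/
def canonicalWords {D : Type*} [LinearOrder D] [OrderBot D] (L : Language D) : Set (List D) :=
  {w | w ∈ L ∧ ¬ ∃ m : ℕ, ∃ v ∈ L, w = List.replicate (m + 1) ⊥ ++ v}

/-- An abstract numeration system with zeros over the ordered alphabet `D` (finite in all uses),
whose zero is its least element `⊥`. Infinitely many words without leading zeros are required, so
that every natural number has a representation; in particular the language is infinite. -/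
structure NumerationSystem (D : Type*) [LinearOrder D] [OrderBot D] where
  /-- the language of valid representations -/
  language : Language D
  nil_mem : [] ∈ language
  zero_cons_mem_iff : ∀ w : List D, ⊥ :: w ∈ language ↔ w ∈ language
  infinite_canonical : (canonicalWords language).Infinite

namespace NumerationSystem

variable {D : Type*} [LinearOrder D] [OrderBot D]

/-- The number of canonical words that precede `w` in radix order. -/
noncomputable def position (N : NumerationSystem D) (w : List D) : ℕ :=
  {v | v ∈ canonicalWords N.language ∧ List.Shortlex (· < ·) v w}.ncard

theorem finite_preceding [Finite D] (N : NumerationSystem D) (w : List D) :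
    {v | v ∈ canonicalWords N.language ∧ List.Shortlex (· < ·) v w}.Finite := by
  refine (List.finite_length_le D w.length).subset ?_
  rintro v ⟨-, hv⟩
  rcases List.shortlex_def.mp hv with h | h
  · exact h.le
  · exact h.1.le

theorem shortlex_trans {u v w : List D} (h₁ : List.Shortlex (· < ·) u v)
    (h₂ : List.Shortlex (· < ·) v w) : List.Shortlex (· < ·) u w := by
  rw [List.shortlex_def] at *
  rcases h₁ with h₁ | ⟨h₁, l₁⟩ <;> rcases h₂ with h₂ | ⟨h₂, l₂⟩
  · exact Or.inl (h₁.trans h₂)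
  · exact Or.inl (h₂ ▸ h₁)
  · exact Or.inl (h₁ ▸ h₂)
  · exact Or.inr ⟨h₁.trans h₂, lt_trans (show u < v from l₁) (show v < w from l₂)⟩

theorem position_lt [Finite D] (N : NumerationSystem D) {v w : List D}
    (hv : v ∈ canonicalWords N.language) (h : List.Shortlex (· < ·) v w) :
    N.position v < N.position w := by
  refine Set.ncard_lt_ncard ?_ (N.finite_preceding w)
  refine ⟨fun u hu => ⟨hu.1, shortlex_trans hu.2 h⟩, fun hsub => ?_⟩
  exact Std.Irrefl.irrefl (r := List.Shortlex (α := D) (· < ·)) v (hsub ⟨hv, h⟩).2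

theorem position_injOn [Finite D] (N : NumerationSystem D) :
    Set.InjOn N.position (canonicalWords N.language) := by
  intro v hv w hw h
  by_contra hne
  rcases trichotomous_of (List.Shortlex (α := D) (· < ·)) v w with h' | h' | h'
  · exact absurd h (N.position_lt hv h').ne
  · exact hne h'
  · exact absurd h (N.position_lt hw h').ne'

theorem existsUnique_rep [Finite D] (N : NumerationSystem D) (n : ℕ) :
    ∃! w, w ∈ canonicalWords N.language ∧ N.position w = n := by
  have hfin : {v | v ∈ canonicalWords N.language ∧ N.position v < n}.Finite := by
    refine Set.Finite.of_finite_image ((Set.finite_Iio n).subset ?_)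
      (N.position_injOn.mono fun v hv => hv.1)
    rintro _ ⟨v, hv, rfl⟩
    exact hv.2
  obtain ⟨v₀, hv₀, hv₀'⟩ := N.infinite_canonical.exists_notMem_finite hfin
  have hne : {v | v ∈ canonicalWords N.language ∧ n ≤ N.position v}.Nonempty :=
    ⟨v₀, hv₀, not_lt.mp fun h => hv₀' ⟨hv₀, h⟩⟩
  have wf : WellFounded (List.Shortlex (α := D) (· < ·)) := List.Shortlex.wf wellFounded_lt
  obtain ⟨w, ⟨hw, hnw⟩, hmin⟩ := wf.has_min _ hne
  have hle : N.position w ≤ n := by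
    have himg : N.position '' {v | v ∈ canonicalWords N.language ∧
        List.Shortlex (· < ·) v w} ⊆ Set.Iio n := by
      rintro _ ⟨v, hv, rfl⟩
      by_contra h
      exact hmin v ⟨hv.1, not_lt.mp h⟩ hv.2
    calc N.position w = (N.position '' {v | v ∈ canonicalWords N.language ∧
          List.Shortlex (· < ·) v w}).ncard :=
          (Set.InjOn.ncard_image (N.position_injOn.mono fun v hv => hv.1)).symm
      _ ≤ (Set.Iio n).ncard := Set.ncard_le_ncard himg (Set.finite_Iio n)
      _ = n := by simp
  exact ⟨w, ⟨hw, le_antisymm hle hnw⟩, fun v hv =>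
    N.position_injOn hv.1 hw (hv.2.trans (le_antisymm hle hnw).symm)⟩

/-- `rep(n)`: the `n`th element (from `0`) of `L \ 0⁺L` in radix order. -/
noncomputable def rep [Finite D] (N : NumerationSystem D) (n : ℕ) : List D :=
  (N.existsUnique_rep n).choose

/-- `val(u)` for `u ∈ L`: remove the leading zeros and take the index of the result in the
enumeration `rep` (see `val_eq_iff`); it is only used for words `u ∈ L`. -/
noncomputable def val (N : NumerationSystem D) (u : List D) : ℕ :=
  N.position (u.dropWhile fun d => decide (d = ⊥))

theorem rep_mem [Finite D] (N : NumerationSystem D) (n : ℕ) :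
    N.rep n ∈ canonicalWords N.language :=
  (N.existsUnique_rep n).choose_spec.1.1

theorem position_rep [Finite D] (N : NumerationSystem D) (n : ℕ) :
    N.position (N.rep n) = n :=
  (N.existsUnique_rep n).choose_spec.1.2

theorem replicate_append_mem_iff (N : NumerationSystem D) (m : ℕ) (w : List D) :
    List.replicate m ⊥ ++ w ∈ N.language ↔ w ∈ N.language := by
  induction m with
  | zero => simp
  | succ m ih => rw [List.replicate_succ, List.cons_append, N.zero_cons_mem_iff, ih]

theorem exists_eq_replicate_append_dropWhile (u : List D) :
    ∃ m : ℕ, u = List.replicate m ⊥ ++ u.dropWhile fun d => decide (d = ⊥) := by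
  induction u with
  | nil => exact ⟨0, by simp⟩
  | cons d u ih =>
    by_cases h : d = ⊥
    · obtain ⟨m, hm⟩ := ih
      refine ⟨m + 1, ?_⟩
      rw [List.dropWhile_cons_of_pos (by simpa using h), List.replicate_succ, List.cons_append,
        ← hm, h]
    · exact ⟨0, by rw [List.dropWhile_cons_of_neg (by simpa using h)]; simp⟩

theorem dropWhile_of_canonical (N : NumerationSystem D) {w : List D}
    (hw : w ∈ canonicalWords N.language) (m : ℕ) :
    (List.replicate m ⊥ ++ w).dropWhile (fun d => decide (d = ⊥)) = w := by
  induction m with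
  | zero =>
    cases w with
    | nil => simp
    | cons d w =>
      by_cases h : d = ⊥
      · subst h
        exact absurd ⟨0, w, (N.zero_cons_mem_iff w).1 hw.1, by simp⟩ hw.2
      · simp [h]
  | succ m ih => rw [List.replicate_succ, List.cons_append, List.dropWhile_cons_of_pos (by simp), ih]

theorem dropWhile_mem_canonical (N : NumerationSystem D) {u : List D} (hu : u ∈ N.language) :
    u.dropWhile (fun d => decide (d = ⊥)) ∈ canonicalWords N.language := by
  obtain ⟨m, hm⟩ := exists_eq_replicate_append_dropWhile u
  refine ⟨(N.replicate_append_mem_iff m _).1 (hm ▸ hu), ?_⟩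
  rintro ⟨k, v, -, hv⟩
  have hidem := List.dropWhile_idempotent (fun d : D => decide (d = ⊥)) u
  rw [hv, List.replicate_succ, List.cons_append,
    List.dropWhile_cons_of_pos (by simp)] at hidem
  have h := congrArg List.length hidem
  have h' := (List.dropWhile_sublist (fun d : D => decide (d = ⊥))
    (l := List.replicate k ⊥ ++ v)).length_le
  rw [List.length_cons] at h
  omega

/-- For a valid word `u`, the number `val(u)` is the unique `n` with `u ∈ 0* rep(n)`. -/
theorem val_eq_iff [Finite D] (N : NumerationSystem D) {u : List D} (hu : u ∈ N.language)
    (n : ℕ) : N.val u = n ↔ ∃ m : ℕ, u = List.replicate m ⊥ ++ N.rep n := by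
  constructor
  · intro h
    obtain ⟨m, hm⟩ := exists_eq_replicate_append_dropWhile u
    refine ⟨m, ?_⟩
    have : u.dropWhile (fun d => decide (d = ⊥)) = N.rep n :=
      N.position_injOn (N.dropWhile_mem_canonical hu) (N.rep_mem n)
        (h.trans (N.position_rep n).symm)
    rw [← this]
    exact hm
  · rintro ⟨m, rfl⟩
    rw [val, N.dropWhile_of_canonical (N.rep_mem n), N.position_rep]

/-- The addition relation, as a language over the alphabet `D × D × D` (a word over that alphabet
is a triple of words of equal length). -/
def additionLanguage (N : NumerationSystem D) : Language (D × D × D) :=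
  {w | w.map (fun d => d.1) ∈ N.language ∧ w.map (fun d => d.2.1) ∈ N.language ∧
    w.map (fun d => d.2.2) ∈ N.language ∧
    N.val (w.map fun d => d.1) + N.val (w.map fun d => d.2.1) = N.val (w.map fun d => d.2.2)}

/-- A numeration system is regular if its language and its addition relation are regular. -/
def IsRegular (N : NumerationSystem D) : Prop :=
  N.language.IsRegular ∧ N.additionLanguage.IsRegular

end NumerationSystem

/-! ### Automatic, synchronized and regular sequences -/

/-- A deterministic automaton with a partial output function. -/
structure DFAO (D A σ : Type*) where
  step : σ → D → σ
  start : σ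
  output : σ → Option A

/-- The output, if any, of the automaton on the input `u`, read from left to right. -/
def DFAO.eval {D A σ : Type*} (M : DFAO D A σ) (u : List D) : Option A :=
  M.output (u.foldl M.step M.start)

namespace NumerationSystem

variable {D : Type*} [LinearOrder D] [OrderBot D]

/-- `x` is `N`-automatic: some finite DFAO has an output exactly on the valid words `u`, and this
output is `x[val(u)]`. -/
def IsAutomatic {A : Type*} (N : NumerationSystem D) (x : ℕ → A) : Prop :=
  ∃ (σ : Type) (_ : Finite σ) (M : DFAO D A σ), ∀ u : List D,
    (u ∈ N.language → M.eval u = some (x (N.val u))) ∧ (u ∉ N.language → M.eval u = none)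

/-- `s : ℕ → ℕ^ι` is `N`-synchronized: the tuples `⟨u, (v_c)_c⟩` of valid words of equal length
such that `s(val(u)) = (val(v_c))_c` form a regular language over the alphabet `D × D^ι`. -/
def IsSynchronized {ι : Type*} (N : NumerationSystem D) (s : ℕ → ι → ℕ) : Prop :=
  Language.IsRegular
    ({w | w.map (fun d => d.1) ∈ N.language ∧ (∀ c, w.map (fun d => d.2 c) ∈ N.language) ∧
      ∀ c, s (N.val (w.map fun d => d.1)) c = N.val (w.map fun d => d.2 c)} :
      Language (D × (ι → D)))

/-- `f` is `N`-regular: `f(n) = row · μ(rep(n)) · col` for a linear representation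
`(row, μ, col)` with complex entries. -/
def IsRegularSequence [Finite D] (N : NumerationSystem D) (f : ℕ → ℂ) : Prop :=
  ∃ (m : ℕ) (row col : Fin m → ℂ) (μ : FreeMonoid D →* Matrix (Fin m) (Fin m) ℂ),
    ∀ n : ℕ, f n = row ⬝ᵥ Matrix.mulVec (μ (FreeMonoid.ofList (N.rep n))) col

end NumerationSystem

/-!
Call a relation on natural numbers *recognizable* if the tuples of representations of its members,
padded by zeros to equal length, form a regular language. In a regular numeration system the
recognizable relations contain addition and are closed under Boolean operations, substitution of
variables, and existential quantification; for the last, the quantified component may be longer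
than the others, so that the projected automaton starts in all states that it can reach while these
others read only zeros (`Language.IsRegular.map_deletePadding`,
`NumerationSystem.Recognizable.exists`). Hence every relation that is first-order definable from
addition, the letters of an automatic sequence, and a synchronized sequence is recognizable.

The relation "the windows of `x` of length `n` at `i` and `j` are `k`-abelian equivalent" is of this
kind. For `n = m + (k - 1)`, an occurrence of a word of length at most `k` either lies in the prefix
of length `k - 1` of the window or ends with one of its `m` blocks of length `k`. The equivalence
therefore says that both windows have the same numbers of blocks of length `k`, which are
differences of two prefix Parikh vectors of the block code, and that their prefixes of length
`k - 1` are `(k - 1)`-abelian equivalent, which depends only on the letters of the block code at `i`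
and `j` (`kAbelianEquiv_factorAt_add_iff`). The finitely many lengths below `k - 1` are also decided
by these two letters.

So "`i` is the first position at which some class of length-`n` factors occurs" is recognizable, and
the complexity at `n` is the number of such `i`. The number of `i` related to `n` by a recognizable
relation is a regular sequence if it is finite for every `n`: transition matrices count the words
that have the length of `rep n` and are accepted together with it, and the entry of the row vector
at a state counts the excess initial parts, read against leading zeros, that lead to this state
(`NumerationSystem.Recognizable.isRegularSequence_ncard`). If there are infinitely many such initial
parts for a state, the entry is `0` by the convention for `Set.ncard`; this is harmless, because by
finiteness no `rep n` has an accepted completion from such a state.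
-/

/-! ### Closure properties of regular languages -/

namespace Language

theorem IsRegular.of_mem_iff {α : Type*} {L L' : Language α} (h : L.IsRegular)
    (hL : ∀ w, w ∈ L' ↔ w ∈ L) : L'.IsRegular := by
  have : L' = L := Set.ext hL
  rwa [this]

theorem isRegular_univ {α : Type*} : Language.IsRegular ({_w | True} : Language α) :=
  ⟨Unit, inferInstance, ⟨fun _ _ => (), (), Set.univ⟩, Set.ext fun _ => Iff.rfl⟩

theorem IsRegular.comap {α β : Type*} {L : Language β} (h : L.IsRegular) (f : α → β) :
    Language.IsRegular ({w | w.map f ∈ L} : Language α) := by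
  obtain ⟨σ, _, M, rfl⟩ := h
  exact ⟨σ, inferInstance, M.comap f, M.accepts_comap f⟩

theorem IsRegular.and {α : Type*} {L L' : Language α} (h : L.IsRegular) (h' : L'.IsRegular) :
    Language.IsRegular ({w | w ∈ L ∧ w ∈ L'} : Language α) :=
  (h.inf h').of_mem_iff fun _ => Iff.rfl

theorem IsRegular.forall {α ι : Type*} [Finite ι] {L : ι → Language α}
    (h : ∀ i, (L i).IsRegular) : Language.IsRegular ({w | ∀ i, w ∈ L i} : Language α) := by
  classical
  have := Fintype.ofFinite ι
  have key : ∀ s : Finset ι, Language.IsRegular ({w | ∀ i ∈ s, w ∈ L i} : Language α) := by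
    intro s
    induction s using Finset.induction_on with
    | empty => exact isRegular_univ.of_mem_iff fun w =>
        ⟨fun _ => trivial, fun _ i hi => absurd hi (Finset.notMem_empty i)⟩
    | insert i s _ ih =>
      refine ((h i).and ih).of_mem_iff fun w => ?_
      exact Finset.forall_mem_insert _ _ _
  refine (key Finset.univ).of_mem_iff fun w => ?_
  exact ⟨fun hw i _ => hw i, fun hw i => hw i (Finset.mem_univ i)⟩

/-- Projecting a regular language along a letter map and then deleting any number of leading
letters `z` gives a regular language. This is how an automaton quantifies existentially over
a component that may be longer than the remaining ones. -/
theorem IsRegular.map_deletePadding {α β : Type*} {L : Language α} (h : L.IsRegular)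
    (f : α → β) (z : β) :
    Language.IsRegular
      ({w | ∃ l : ℕ, ∃ v ∈ L, v.map f = List.replicate l z ++ w} : Language β) := by
  classical
  obtain ⟨σ, _, M, rfl⟩ := h
  -- The padding is read in advance: its possible end states are the initial states.
  let M' : NFA β σ :=
    { step := fun s b => {t | ∃ a, f a = b ∧ M.step s a = t}
      start := {s | ∃ l : ℕ, ∃ v : List α, v.map f = List.replicate l z ∧ M.eval v = s}
      accept := M.accept }
  have key : ∀ (w : List β) (S : Set σ) (t : σ), t ∈ M'.evalFrom S w ↔
      ∃ s ∈ S, ∃ v : List α, v.map f = w ∧ M.evalFrom s v = t := by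
    intro w
    induction w with
    | nil => intro S t; simp
    | cons b w ih =>
      intro S t
      rw [NFA.evalFrom_cons, ih]
      constructor
      · rintro ⟨s, hs, v, rfl, rfl⟩
        obtain ⟨r, hr, a, rfl, rfl⟩ := NFA.mem_stepSet.1 hs
        exact ⟨r, hr, a :: v, rfl, rfl⟩
      · rintro ⟨s, hs, v, hv, rfl⟩
        obtain ⟨a, v, rfl, rfl, rfl⟩ := List.map_eq_cons_iff.1 hv
        exact ⟨M.step s a, NFA.mem_stepSet.2 ⟨s, hs, a, rfl, rfl⟩, v, rfl, rfl⟩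
  refine ⟨Set σ, inferInstance, M'.toDFA, ?_⟩
  rw [NFA.toDFA_correct]
  ext w
  rw [NFA.mem_accepts]
  constructor
  · rintro ⟨t, ht, hw⟩
    obtain ⟨s, ⟨l, u, hu, rfl⟩, v, rfl, rfl⟩ := (key _ _ _).1 hw
    refine ⟨l, u ++ v, ?_, by rw [List.map_append, hu]⟩
    rw [DFA.mem_accepts, DFA.eval, DFA.evalFrom_of_append]
    exact ht
  · rintro ⟨l, v, hv, hw⟩
    obtain ⟨v₁, v₂, rfl, h₁, h₂⟩ := List.map_eq_append_iff.1 hw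
    rw [DFA.mem_accepts, DFA.eval, DFA.evalFrom_of_append] at hv
    exact ⟨_, hv, (key _ _ _).2 ⟨_, ⟨l, v₁, h₁, rfl⟩, v₂, h₂, rfl⟩⟩

end Language

/-! ### Words over product alphabets -/

/-- Words of equal length can be zipped into one word over the product alphabet. -/
theorem List.exists_map_eval_eq {ι D : Type*} {n : ℕ} (u : ι → List D)
    (h : ∀ i, (u i).length = n) :
    ∃ w : List (ι → D), w.length = n ∧ ∀ i, w.map (fun d => d i) = u i := by
  refine ⟨List.ofFn fun (j : Fin n) i => (u i)[j]'(by rw [h]; exact j.2), by simp, fun i => ?_⟩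
  apply List.ext_getElem <;> simp [h]

theorem List.ext_map_eval {ι D : Type*} {v w : List (ι → D)} (hl : v.length = w.length)
    (h : ∀ i, v.map (fun d => d i) = w.map fun d => d i) : v = w := by
  refine List.ext_getElem hl fun j h₁ h₂ => funext fun i => ?_
  have := List.getElem_of_eq (h i) (i := j) (by simpa using h₁)
  simpa using this

/-! ### Relations recognizable in a numeration system -/

namespace NumerationSystem

variable {D : Type*} [LinearOrder D] [OrderBot D]

theorem val_replicate_append (N : NumerationSystem D) (m : ℕ) (u : List D) :
    N.val (List.replicate m ⊥ ++ u) = N.val u := by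
  induction m with
  | zero => simp
  | succ m ih =>
    rw [← ih, val, List.replicate_succ, List.cons_append, List.dropWhile_cons_of_pos (by simp), val]

theorem rep_mem_language [Finite D] (N : NumerationSystem D) (n : ℕ) : N.rep n ∈ N.language :=
  (N.rep_mem n).1

theorem val_rep [Finite D] (N : NumerationSystem D) (n : ℕ) : N.val (N.rep n) = n :=
  (N.val_eq_iff (N.rep_mem_language n) n).2 ⟨0, by simp⟩

/-- The tuples of valid words of equal length whose values satisfy the relation `R`, as a language
over the product alphabet. -/
def relationLanguage (N : NumerationSystem D) {ι : Type*} (R : (ι → ℕ) → Prop) :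
    Language (ι → D) :=
  {w | (∀ i, w.map (fun d => d i) ∈ N.language) ∧ R fun i => N.val (w.map fun d => d i)}

/-- A relation on natural numbers, with places indexed by `ι`, is recognizable if the words of
equal length that represent its members form a regular language. -/
def Recognizable (N : NumerationSystem D) {ι : Type*} (R : (ι → ℕ) → Prop) : Prop :=
  (N.relationLanguage R).IsRegular

/-- A function is recognizable if its graph is, the value being placed at `none`. -/
def RecognizableFun (N : NumerationSystem D) {ι : Type*} (F : (ι → ℕ) → ℕ) : Prop :=
  N.Recognizable fun a : Option ι → ℕ => a none = F fun i => a (some i)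

variable {N : NumerationSystem D} {ι κ : Type*}

theorem Recognizable.of_iff {R R' : (ι → ℕ) → Prop} (h : N.Recognizable R)
    (hR : ∀ a, R' a ↔ R a) : N.Recognizable R' :=
  Language.IsRegular.of_mem_iff h fun _ => and_congr_right fun _ => hR _

theorem Recognizable.and {R R' : (ι → ℕ) → Prop} (h : N.Recognizable R)
    (h' : N.Recognizable R') : N.Recognizable fun a => R a ∧ R' a :=
  (Language.IsRegular.and h h').of_mem_iff fun _ => and_and_left

theorem IsRegular.recognizable_true [Finite ι] (hN : N.IsRegular) :
    N.Recognizable fun _ : ι → ℕ => True :=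
  (Language.IsRegular.forall fun i => hN.1.comap fun d : ι → D => d i).of_mem_iff fun _ =>
    and_iff_left trivial

theorem Recognizable.not [Finite ι] (hN : N.IsRegular) {R : (ι → ℕ) → Prop}
    (h : N.Recognizable R) : N.Recognizable fun a => ¬ R a := by
  refine (Language.IsRegular.and hN.recognizable_true
    (Language.IsRegular.compl h)).of_mem_iff fun w => ?_
  exact ⟨fun hw => ⟨⟨hw.1, trivial⟩, fun h' => hw.2 h'.2⟩,
    fun hw => ⟨hw.1.1, fun h' => hw.2 ⟨hw.1.1, h'⟩⟩⟩

theorem Recognizable.or [Finite ι] (hN : N.IsRegular) {R R' : (ι → ℕ) → Prop}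
    (h : N.Recognizable R) (h' : N.Recognizable R') : N.Recognizable fun a => R a ∨ R' a :=
  (((h.not hN).and (h'.not hN)).not hN).of_iff fun _ => by tauto

theorem IsRegular.recognizable_const [Finite ι] (hN : N.IsRegular) (p : Prop) :
    N.Recognizable fun _ : ι → ℕ => p := by
  by_cases hp : p
  · exact hN.recognizable_true.of_iff fun _ => iff_true_intro hp
  · exact (hN.recognizable_true.not hN).of_iff fun _ => by simp [hp]

theorem Recognizable.forall_finite [Finite ι] [Finite κ] (hN : N.IsRegular)
    {R : κ → (ι → ℕ) → Prop} (h : ∀ k, N.Recognizable (R k)) :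
    N.Recognizable fun a => ∀ k, R k a :=
  (Language.IsRegular.and (hN.recognizable_true (ι := ι))
    (Language.IsRegular.forall h)).of_mem_iff fun _ =>
    ⟨fun hw => ⟨⟨hw.1, trivial⟩, fun k => ⟨hw.1, hw.2 k⟩⟩,
      fun hw => ⟨hw.1.1, fun k => (hw.2 k).2⟩⟩

theorem Recognizable.exists_finite [Finite ι] [Finite κ] (hN : N.IsRegular)
    {R : κ → (ι → ℕ) → Prop} (h : ∀ k, N.Recognizable (R k)) :
    N.Recognizable fun a => ∃ k, R k a :=
  ((Recognizable.forall_finite hN fun k => (h k).not hN).not hN).of_iff fun _ => by simp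

theorem Recognizable.comap [Finite ι] (hN : N.IsRegular) {R : (κ → ℕ) → Prop}
    (h : N.Recognizable R) (f : κ → ι) : N.Recognizable fun a => R fun k => a (f k) := by
  refine (Language.IsRegular.and hN.recognizable_true
    (Language.IsRegular.comap h fun (d : ι → D) k => d (f k))).of_mem_iff fun w => ?_
  have key : ∀ k, (w.map fun (d : ι → D) k => d (f k)).map (fun d => d k) =
      w.map fun d => d (f k) := fun k => by rw [List.map_map]; rfl
  change _ ∧ _ ↔ (_ ∧ _) ∧ ((∀ k, _ ∈ _) ∧ R _)
  simp only [key]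
  tauto

/-- Recognizable relations are closed under existential quantification over tuples. -/
theorem Recognizable.exists [Finite D] [Finite κ] {R : (ι → ℕ) → (κ → ℕ) → Prop}
    (h : N.Recognizable fun c : ι ⊕ κ → ℕ => R (fun i => c (.inl i)) fun k => c (.inr k)) :
    N.Recognizable fun a => ∃ b, R a b := by
  refine (Language.IsRegular.map_deletePadding h (fun d i => d (.inl i))
    (fun _ : ι => (⊥ : D))).of_mem_iff fun w => ?_
  constructor
  · rintro ⟨hw, b, hb⟩
    -- All components are padded to a length that suffices for the representations of `b`.
    obtain ⟨l, hl⟩ : ∃ l : ℕ, ∀ k, (N.rep (b k)).length ≤ l + w.length := by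
      obtain ⟨l, hl⟩ := (Set.finite_range fun k => (N.rep (b k)).length).bddAbove
      exact ⟨l, fun k => (hl ⟨k, rfl⟩).trans (Nat.le_add_right _ _)⟩
    obtain ⟨v, hvl, hv⟩ := List.exists_map_eval_eq (n := l + w.length)
      (Sum.elim (fun i => List.replicate l ⊥ ++ w.map fun d : ι → D => d i)
        fun k => List.replicate (l + w.length - (N.rep (b k)).length) ⊥ ++ N.rep (b k)) (by
          rintro (i | k)
          · simp
          · have := hl k
            simp only [Sum.elim_inr, List.length_append, List.length_replicate]
            omega)
    refine ⟨l, v, ⟨?_, ?_⟩, ?_⟩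
    · rintro (i | k)
      · rw [hv, Sum.elim_inl, replicate_append_mem_iff]
        exact hw i
      · rw [hv, Sum.elim_inr, replicate_append_mem_iff]
        exact N.rep_mem_language _
    · simp only [hv, Sum.elim_inl, Sum.elim_inr, val_replicate_append, val_rep]
      exact hb
    · refine List.ext_map_eval (by simp [hvl]) fun i => ?_
      have := hv (.inl i)
      simp only [List.map_map, List.map_append, List.map_replicate]
      exact this
  · rintro ⟨l, v, ⟨hv, hR⟩, hw⟩
    have key : ∀ i, v.map (fun d => d (.inl i)) =
        List.replicate l ⊥ ++ w.map fun d : ι → D => d i := fun i => by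
      have := congrArg (List.map fun d : ι → D => d i) hw
      simpa only [List.map_map, List.map_append, List.map_replicate, Function.comp_def] using this
    refine ⟨fun i => ?_, fun k => N.val (v.map fun d => d (.inr k)), ?_⟩
    · rw [← N.replicate_append_mem_iff l, ← key]
      exact hv _
    · simpa only [key, val_replicate_append] using hR

theorem Recognizable.exists_nat [Finite D] [Finite ι] (hN : N.IsRegular)
    {R : (ι → ℕ) → ℕ → Prop}
    (h : N.Recognizable fun c : Option ι → ℕ => R (fun i => c (some i)) (c none)) :
    N.Recognizable fun a => ∃ n, R a n := by
  have h' : N.Recognizable fun c : ι ⊕ Unit → ℕ => R (fun i => c (.inl i)) (c (.inr ())) :=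
    Recognizable.comap hN h fun o : Option ι => o.elim (Sum.inr ()) Sum.inl
  exact (Recognizable.exists (R := fun a (b : Unit → ℕ) => R a (b ())) h').of_iff fun a =>
    ⟨fun ⟨n, hn⟩ => ⟨fun _ => n, hn⟩, fun ⟨b, hb⟩ => ⟨b (), hb⟩⟩

theorem IsRegular.recognizable_add_var [Finite ι] (hN : N.IsRegular) (i j l : ι) :
    N.Recognizable fun a : ι → ℕ => a i + a j = a l := by
  have h : N.Recognizable fun a : Fin 3 → ℕ => a 0 + a 1 = a 2 := by
    refine (hN.2.comap fun d : Fin 3 → D => (d 0, d 1, d 2)).of_mem_iff fun w => ?_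
    change (∀ i, _) ∧ _ ↔ _ ∧ _ ∧ _ ∧ _
    simp only [List.map_map, Function.comp_def, Fin.forall_fin_succ]
    simp
    tauto
  exact h.comap hN ![i, j, l]

theorem IsRegular.recognizable_eq_var [Finite D] [Finite ι] (hN : N.IsRegular) (i j : ι) :
    N.Recognizable fun a : ι → ℕ => a i = a j := by
  refine (Recognizable.exists_nat hN (R := fun a n => n + n = n ∧ a i + n = a j)
    ((hN.recognizable_add_var _ _ _).and (hN.recognizable_add_var _ _ _))).of_iff fun a => ?_
  exact ⟨fun h => ⟨0, rfl, h⟩, fun ⟨n, hn, h⟩ => by omega⟩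

theorem IsRegular.recognizableFun_var [Finite D] [Finite ι] (hN : N.IsRegular) (i : ι) :
    N.RecognizableFun fun a : ι → ℕ => a i :=
  hN.recognizable_eq_var _ _

/-- Recognizable functions may be substituted into recognizable relations. -/
theorem Recognizable.subst [Finite D] [Finite ι] [Finite κ] (hN : N.IsRegular)
    {R : (κ → ℕ) → Prop} (h : N.Recognizable R) {F : κ → (ι → ℕ) → ℕ}
    (hF : ∀ k, N.RecognizableFun (F k)) : N.Recognizable fun a => R fun k => F k a := by
  refine (Recognizable.exists (R := fun a b => (∀ k, b k = F k a) ∧ R b)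
    ((Recognizable.forall_finite hN fun k => ?_).and (h.comap hN _))).of_iff fun a => ?_
  · exact Recognizable.comap hN (hF k) fun o : Option ι => o.elim (Sum.inr k) Sum.inl
  · exact ⟨fun hR => ⟨fun k => F k a, fun _ => rfl, hR⟩,
      fun ⟨b, hb, hR⟩ => by rwa [show b = fun k => F k a from funext hb] at hR⟩

theorem RecognizableFun.comap [Finite κ] (hN : N.IsRegular) {F : (ι → ℕ) → ℕ}
    (h : N.RecognizableFun F) (f : ι → κ) : N.RecognizableFun fun a => F fun i => a (f i) :=
  Recognizable.comap hN h (Option.map f)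

theorem RecognizableFun.eq [Finite D] [Finite ι] (hN : N.IsRegular) {F G : (ι → ℕ) → ℕ}
    (hF : N.RecognizableFun F) (hG : N.RecognizableFun G) :
    N.Recognizable fun a => F a = G a :=
  (hN.recognizable_eq_var (0 : Fin 2) 1).subst hN (F := ![F, G]) (by
    simp [Fin.forall_fin_two, hF, hG])

theorem RecognizableFun.add [Finite D] [Finite ι] (hN : N.IsRegular) {F G : (ι → ℕ) → ℕ}
    (hF : N.RecognizableFun F) (hG : N.RecognizableFun G) :
    N.RecognizableFun fun a => F a + G a := by
  have h := (hN.recognizable_add_var (0 : Fin 3) 1 2).subst hN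
    (F := ![fun a : Option ι → ℕ => F fun i => a (some i), fun a => G fun i => a (some i),
      fun a => a none]) (by
        rw [Fin.forall_fin_succ, Fin.forall_fin_two]
        exact ⟨hF.comap hN _, hG.comap hN _, hN.recognizableFun_var _⟩)
  exact h.of_iff fun a => ⟨Eq.symm, Eq.symm⟩

/-- Every singleton is definable from addition: `0` is the idempotent, `1` is the nonzero number
without a decomposition into nonzero summands, and `c + 1` is their sum. -/
theorem IsRegular.recognizableFun_const [Finite D] [Finite ι] (hN : N.IsRegular) (c : ℕ) :
    N.RecognizableFun fun _ : ι → ℕ => c := by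
  suffices h : N.Recognizable fun a : Unit → ℕ => a () = c from
    h.comap hN (fun _ => (none : Option ι))
  have h0 : ∀ {ι' : Type} [Finite ι'] (i : ι'), N.Recognizable fun a : ι' → ℕ => a i = 0 :=
    fun i => (hN.recognizable_add_var i i i).of_iff fun a => by omega
  have h1 : N.Recognizable fun a : Unit → ℕ => a () = 1 := by
    refine ((h0 ()).not hN).and (((Recognizable.exists (κ := Fin 2)
      (R := fun a b => (b 0 ≠ 0 ∧ b 1 ≠ 0) ∧ b 0 + b 1 = a ()) ?_)).not hN) |>.of_iff fun a => ?_
    · exact (((h0 _).not hN).and ((h0 _).not hN)).and (hN.recognizable_add_var _ _ _)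
    · constructor
      · intro h
        refine ⟨by omega, ?_⟩
        rintro ⟨b, hb, hb'⟩
        omega
      · rintro ⟨h, h'⟩
        by_contra hne
        exact h' ⟨![1, a () - 1], by simp; omega, by simp; omega⟩
  induction c with
  | zero => exact h0 ()
  | succ c ih =>
    refine (Recognizable.exists (κ := Fin 2)
      (R := fun (a : Unit → ℕ) b => (b 0 = c ∧ b 1 = 1) ∧ b 0 + b 1 = a ()) ?_).of_iff fun a => ?_
    · exact ((ih.comap hN fun _ => Sum.inr 0).and (h1.comap hN fun _ => Sum.inr 1)).and
        (hN.recognizable_add_var _ _ _)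
    · constructor
      · intro h
        exact ⟨![c, 1], ⟨rfl, rfl⟩, h.symm⟩
      · rintro ⟨b, ⟨h, h'⟩, h''⟩
        omega

theorem RecognizableFun.lt [Finite D] [Finite ι] (hN : N.IsRegular) {F G : (ι → ℕ) → ℕ}
    (hF : N.RecognizableFun F) (hG : N.RecognizableFun G) :
    N.Recognizable fun a => F a < G a := by
  refine (Recognizable.exists_nat hN (ι := ι)
    (R := fun a n => F a + (n + 1) = G a) ?_).of_iff fun a => ?_
  · have hF' := hF.comap hN (some : ι → Option ι)
    have hG' := hG.comap hN (some : ι → Option ι)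
    exact (hF'.add hN ((hN.recognizableFun_var none).add hN (hN.recognizableFun_const 1))).eq
      hN hG'
  · exact ⟨fun h => ⟨G a - F a - 1, by omega⟩, fun ⟨n, hn⟩ => by omega⟩

end NumerationSystem

/-! ### Counting with a recognizable relation -/

namespace NumerationSystem

variable {D : Type*} [LinearOrder D] [OrderBot D] {N : NumerationSystem D}

theorem head?_ne_bot_of_canonical {w : List D} (hw : w ∈ canonicalWords N.language) :
    w.head? ≠ some ⊥ := by
  intro h
  obtain ⟨v, rfl⟩ := List.head?_eq_some_iff.1 h
  exact hw.2 ⟨0, v, (N.zero_cons_mem_iff v).1 hw.1, by simp⟩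

/-- The word over the alphabet of pairs with components `u` and `v`. -/
def pairWord {D : Type*} (u v : List D) : List (Fin 2 → D) :=
  List.zipWith (fun d e => ![d, e]) u v

theorem pairWord_append {D : Type*} {u u' v v' : List D} (h : u.length = v.length) :
    pairWord (u ++ u') (v ++ v') = pairWord u v ++ pairWord u' v' :=
  List.zipWith_append h

theorem pairWord_mem_relationLanguage {R : (Fin 2 → ℕ) → Prop} {u v : List D}
    (h : u.length = v.length) : pairWord u v ∈ N.relationLanguage R ↔
      (u ∈ N.language ∧ v ∈ N.language) ∧ R ![N.val u, N.val v] := by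
  have h0 : (pairWord u v).map (fun d => d 0) = u :=
    List.ext_getElem (by simp [pairWord, h]) (by simp [pairWord])
  have h1 : (pairWord u v).map (fun d => d 1) = v :=
    List.ext_getElem (by simp [pairWord, h]) (by simp [pairWord])
  have hval : (fun i => N.val ((pairWord u v).map fun d => d i)) = ![N.val u, N.val v] := by
    funext i
    fin_cases i
    · exact congrArg N.val h0
    · exact congrArg N.val h1
  change (∀ i, _ ∈ _) ∧ R _ ↔ _
  rw [hval, Fin.forall_fin_two, h0, h1]

/-- The words of the length of `w` which, paired with `w`, lead the automaton from the state `s`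
to acceptance. -/
def acceptedCompletions {D σ : Type*} (M : DFA (Fin 2 → D) σ) (s : σ) (w : List D) :
    Set (List D) :=
  {v | v.length = w.length ∧ M.evalFrom s (pairWord w v) ∈ M.accept}

/-- The number of accepted completions of `w` is given by the product of the transition-counting
matrices along `w`. -/
theorem exists_matrix_ncard_acceptedCompletions {D σ : Type*} [Finite D] [Fintype σ]
    [DecidableEq σ] (M : DFA (Fin 2 → D) σ) :
    ∃ μ : FreeMonoid D →* Matrix σ σ ℂ, ∃ col : σ → ℂ, ∀ (w : List D) (s : σ),
      ((acceptedCompletions M s w).ncard : ℂ) =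
        Matrix.mulVec (μ (FreeMonoid.ofList w)) col s := by
  classical
  have := Fintype.ofFinite D
  refine ⟨FreeMonoid.lift fun d => Matrix.of fun s t =>
      (((Finset.univ.filter fun e : D => M.step s ![d, e] = t).card : ℕ) : ℂ),
    fun s => if s ∈ M.accept then 1 else 0, fun w => ?_⟩
  induction w with
  | nil =>
    intro s
    have : acceptedCompletions M s [] = if s ∈ M.accept then {[]} else ∅ := by
      ext v
      split_ifs with hs
      · simp only [acceptedCompletions, Set.mem_ofPred_eq, Set.mem_singleton_iff]
        constructor
        · rintro ⟨hv, -⟩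
          simpa using hv
        · rintro rfl
          exact ⟨rfl, hs⟩
      · simp only [acceptedCompletions, Set.mem_ofPred_eq, Set.mem_empty_iff_false, iff_false]
        rintro ⟨hv, h⟩
        obtain rfl : v = [] := by simpa using hv
        exact hs h
    rw [this, FreeMonoid.ofList_nil, map_one, Matrix.one_mulVec]
    split_ifs <;> simp
  | cons d w ih =>
    intro s
    have hfin : ∀ t, Finite (acceptedCompletions M t w) := fun t =>
      ((List.finite_length_eq D w.length).subset fun v hv => hv.1).to_subtype
    let e : acceptedCompletions M s (d :: w) ≃
        Σ e : D, acceptedCompletions M (M.step s ![d, e]) w :=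
      { toFun := fun v => match v with
          | ⟨[], hv⟩ => absurd hv.1 (by simp)
          | ⟨e :: v, hv⟩ => ⟨e, v, by simpa using hv.1, hv.2⟩
        invFun := fun p => ⟨p.1 :: p.2.1, by simp [p.2.2.1], p.2.2.2⟩
        left_inv := fun v => match v with
          | ⟨[], hv⟩ => absurd hv.1 (by simp)
          | ⟨e :: v, hv⟩ => rfl
        right_inv := fun p => rfl }
    rw [← Nat.card_coe_set_eq, Nat.card_congr e, Nat.card_sigma, Nat.cast_sum]
    simp only [Nat.card_coe_set_eq, ih]
    rw [FreeMonoid.ofList_cons, map_mul, ← Matrix.mulVec_mulVec, FreeMonoid.lift_eval_of]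
    conv_rhs => rw [Matrix.mulVec, dotProduct]
    simp only [Matrix.of_apply, Finset.card_filter, Nat.cast_sum, Finset.sum_mul]
    rw [Finset.sum_comm]
    refine Finset.sum_congr rfl fun e _ => ?_
    simp

/-- The pairs `(v₁, v₂)` such that `v₂` has the length of `w`, `v₁` does not start with `⊥`, and
`v₁ v₂` is accepted together with `w` padded by leading `⊥`. So `v₁ v₂` starts with `⊥` only if it
has the length of `w`, and each number related to the value of `w` has exactly one representation
of this form. -/
def splitRepresentations {D σ : Type*} [LinearOrder D] [OrderBot D] (M : DFA (Fin 2 → D) σ)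
    (w : List D) : Set (List D × List D) :=
  {p | p.1.head? ≠ some ⊥ ∧ p.2.length = w.length ∧
    pairWord (List.replicate p.1.length ⊥ ++ w) (p.1 ++ p.2) ∈ M.accepts}

theorem bijOn_splitRepresentations [Finite D] {σ : Type*} (M : DFA (Fin 2 → D) σ)
    {R : (Fin 2 → ℕ) → Prop} (hM : M.accepts = N.relationLanguage R) (n : ℕ) :
    Set.BijOn (fun p => N.val (p.1 ++ p.2)) (splitRepresentations M (N.rep n))
      {i | R ![n, i]} := by
  have hmem : ∀ p : List D × List D, p.2.length = (N.rep n).length →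
      (pairWord (List.replicate p.1.length ⊥ ++ N.rep n) (p.1 ++ p.2) ∈ M.accepts ↔
        p.1 ++ p.2 ∈ N.language ∧ R ![n, N.val (p.1 ++ p.2)]) := by
    intro p hp
    rw [hM, pairWord_mem_relationLanguage (by simp [hp]), replicate_append_mem_iff,
      val_replicate_append, val_rep]
    simp [N.rep_mem_language n]
  refine ⟨?_, ?_, ?_⟩
  · rintro p ⟨-, hp, hacc⟩
    exact ((hmem p hp).1 hacc).2
  · have key : ∀ p ∈ splitRepresentations M (N.rep n), ∀ q ∈ splitRepresentations M (N.rep n),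
        N.val (p.1 ++ p.2) = N.val (q.1 ++ q.2) → p.1.length ≤ q.1.length → p = q := by
      rintro ⟨p₁, p₂⟩ ⟨hp₁, hp₂, hp⟩ ⟨q₁, q₂⟩ ⟨hq₁, hq₂, hq⟩ hval hle
      replace hp := ((hmem _ hp₂).1 hp).1
      replace hq := ((hmem _ hq₂).1 hq).1
      dsimp only at *
      obtain ⟨a, ha⟩ := (N.val_eq_iff hp _).1 rfl
      obtain ⟨b, hb⟩ := (N.val_eq_iff hq _).1 hval.symm
      have hla := congrArg List.length ha
      have hlb := congrArg List.length hb
      simp only [List.length_append, List.length_replicate] at hla hlb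
      -- A longer representation would start with `⊥`, which the condition on `q₁` excludes.
      have hab : a = b := by
        by_contra hne
        have hlt : p₁.length < q₁.length := by omega
        have hb0 : b ≠ 0 := by omega
        obtain ⟨b, rfl⟩ := Nat.exists_eq_succ_of_ne_zero hb0
        apply hq₁
        cases q₁ with
        | nil => simp at hlt
        | cons d q₁ =>
          rw [List.replicate_succ, List.cons_append, List.cons_append] at hb
          simp [(List.cons.inj hb).1]
      have heq : p₁ ++ p₂ = q₁ ++ q₂ := by rw [ha, hb, hab]
      obtain ⟨rfl, rfl⟩ := List.append_inj heq (by omega)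
      rfl
    intro p hp q hq h
    rcases le_total p.1.length q.1.length with hle | hle
    · exact key p hp q hq h hle
    · exact (key q hq p hp h.symm hle).symm
  · intro i hi
    rcases le_total (N.rep n).length (N.rep i).length with hle | hle
    · refine ⟨((N.rep i).take ((N.rep i).length - (N.rep n).length),
        (N.rep i).drop ((N.rep i).length - (N.rep n).length)), ⟨?_, ?_, (hmem _ ?_).2 ?_⟩, ?_⟩
      · intro h
        refine head?_ne_bot_of_canonical (N.rep_mem i) ?_
        rw [List.head?_take] at h
        split_ifs at h
        exact h
      · simp only [List.length_drop]; omega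
      · simp only [List.length_drop]; omega
      · rw [List.take_append_drop, val_rep]
        exact ⟨N.rep_mem_language i, hi⟩
      · dsimp only
        rw [List.take_append_drop, val_rep]
    · refine ⟨([], List.replicate ((N.rep n).length - (N.rep i).length) ⊥ ++ N.rep i),
        ⟨by simp, ?_, (hmem _ ?_).2 ?_⟩, ?_⟩
      · simp only [List.length_append, List.length_replicate]; omega
      · simp only [List.length_append, List.length_replicate]; omega
      · rw [List.nil_append, replicate_append_mem_iff, val_replicate_append, val_rep]
        exact ⟨N.rep_mem_language i, hi⟩
      · dsimp only
        rw [List.nil_append, val_replicate_append, val_rep]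

/-- If a recognizable relation relates each `n` to finitely many numbers, then their number is a
regular sequence. The words to be counted are cut at the length of `rep(n)`: a row vector counts
the initial parts, and transition matrices count the remaining ones. -/
theorem Recognizable.isRegularSequence_ncard [Finite D] {R : (Fin 2 → ℕ) → Prop}
    (h : N.Recognizable R) (hfin : ∀ n, {i | R ![n, i]}.Finite) :
    N.IsRegularSequence fun n => ({i | R ![n, i]}.ncard : ℂ) := by
  classical
  obtain ⟨σ, _, M, hM⟩ := h
  obtain ⟨μ, col, hμ⟩ := exists_matrix_ncard_acceptedCompletions M
  let P (s : σ) : Set (List D) :=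
    {v | v.head? ≠ some ⊥ ∧ M.eval (pairWord (List.replicate v.length ⊥) v) = s}
  have hcount : ∀ n, {i | R ![n, i]}.ncard =
      ∑ s, (P s).ncard * (acceptedCompletions M s (N.rep n)).ncard := by
    intro n
    have hbij := bijOn_splitRepresentations M hM n
    have hS : (splitRepresentations M (N.rep n)).Finite :=
      Set.Finite.of_finite_image (hbij.image_eq ▸ hfin n) hbij.injOn
    rw [← hbij.image_eq, hbij.injOn.ncard_image, Set.ncard_eq_toFinset_card _ hS,
      Finset.card_eq_sum_card_fiberwise (t := Finset.univ)
        (f := fun p => M.eval (pairWord (List.replicate p.1.length ⊥) p.1))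
        fun _ _ => Finset.mem_coe.2 (Finset.mem_univ _)]
    refine Finset.sum_congr rfl fun s _ => ?_
    rw [← Set.ncard_prod, ← Set.ncard_coe_finset]
    congr 1
    ext p
    simp only [Finset.coe_filter, Set.Finite.mem_toFinset, Set.mem_ofPred_eq, Set.mem_prod, P,
      splitRepresentations, acceptedCompletions]
    rw [pairWord_append (by simp), DFA.mem_accepts, DFA.eval, DFA.evalFrom_of_append]
    constructor
    · rintro ⟨⟨h₁, h₂, h₃⟩, rfl⟩
      exact ⟨⟨h₁, rfl⟩, h₂, h₃⟩
    · rintro ⟨⟨h₁, rfl⟩, h₂, h₃⟩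
      exact ⟨⟨h₁, h₂, h₃⟩, rfl⟩
  let e := Fintype.equivFin σ
  refine ⟨Fintype.card σ, fun s => ((P (e.symm s)).ncard : ℂ), fun s => col (e.symm s),
    ((Matrix.reindexAlgEquiv ℂ ℂ e : _ →* _)).comp μ, fun n => ?_⟩
  dsimp only
  rw [hcount, Nat.cast_sum, dotProduct, ← e.symm.sum_comp]
  refine Finset.sum_congr rfl fun s _ => ?_
  rw [Nat.cast_mul, hμ, Matrix.mulVec, Matrix.mulVec, dotProduct, dotProduct, ← e.symm.sum_comp]
  rfl

end NumerationSystem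

/-! ### Occurrences in windows and sliding-block codes -/

section Occurrences

variable {A C : Type*}

theorem length_factorAt (x : ℕ → A) (i n : ℕ) : (factorAt x i n).length = n := by
  simp [factorAt]

theorem getElem_factorAt (x : ℕ → A) (i n j : ℕ) (h : j < (factorAt x i n).length) :
    (factorAt x i n)[j] = x (i + j) := by
  simp [factorAt]

theorem take_drop_factorAt (x : ℕ → A) {i n p l : ℕ} (h : p + l ≤ n) :
    ((factorAt x i n).drop p).take l = factorAt x (i + p) l := by
  refine List.ext_getElem ?_ fun j h₁ h₂ => ?_
  · simp only [List.length_take, List.length_drop, length_factorAt]; omega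
  · simp [getElem_factorAt, add_assoc]

open Classical in
theorem occurrences_factorAt (x : ℕ → A) (w : List A) (i n : ℕ) :
    occurrences w (factorAt x i n) = ((Finset.range (n + 1)).filter fun p =>
      p + w.length ≤ n ∧ factorAt x (i + p) w.length = w).card := by
  rw [occurrences, ← Set.ncard_coe_finset]
  congr 1
  ext p
  simp only [length_factorAt, Set.mem_ofPred_eq, Finset.coe_filter, Finset.mem_range]
  constructor
  · rintro ⟨h, hw⟩
    exact ⟨by omega, h, by rwa [take_drop_factorAt x h] at hw⟩
  · rintro ⟨-, h, hw⟩
    exact ⟨h, by rwa [take_drop_factorAt x h]⟩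

open Classical in
/-- The number of occurrences of the letter `c` of `y` in the window of length `m` at `i`. -/
noncomputable def windowCount (y : ℕ → C) (c : C) (i m : ℕ) : ℕ :=
  ((Finset.range m).filter fun p => y (i + p) = c).card

theorem prefixParikh_add (y : ℕ → C) (c : C) (i m : ℕ) :
    prefixParikh y (i + m) c = prefixParikh y i c + windowCount y c i m := by
  classical
  induction m with
  | zero => simp [windowCount]
  | succ m ih =>
    have hp : ∀ n, prefixParikh y (n + 1) c = prefixParikh y n c + if y n = c then 1 else 0 := by
      intro n
      simp [prefixParikh, parikh, factorAt, List.range_succ, List.count_append,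
        List.count_singleton]
    rw [← add_assoc, hp, ih, windowCount, windowCount, Finset.range_add_one, Finset.filter_insert]
    split_ifs <;> simp [add_assoc]

open Classical in
/-- Occurrences in a window of length `m + K` are those in its prefix of length `K`, and those
that end with one of the `m` blocks of length `K + 1` in it. -/
theorem occurrences_factorAt_add (x : ℕ → A) {K : ℕ} {w : List A} (hw : w.length ≤ K + 1)
    (i m : ℕ) : occurrences w (factorAt x i (m + K)) = occurrences w (factorAt x i K) +
      ((Finset.range m).filter fun p =>
        (factorAt x (i + p) (K + 1)).drop (K + 1 - w.length) = w).card := by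
  induction m with
  | zero => simp
  | succ m ih =>
    have hdrop : ∀ p, (factorAt x (i + p) (K + 1)).drop (K + 1 - w.length) =
        factorAt x (i + (p + (K + 1 - w.length))) w.length := by
      intro p
      rw [← add_assoc, ← take_drop_factorAt x (n := K + 1) (p := K + 1 - w.length) (by omega),
        List.take_of_length_le]
      simp only [List.length_drop, length_factorAt]; omega
    have hsplit : occurrences w (factorAt x i (m + 1 + K)) = occurrences w (factorAt x i (m + K)) +
        if (factorAt x (i + m) (K + 1)).drop (K + 1 - w.length) = w then 1 else 0 := by
      rw [occurrences_factorAt, occurrences_factorAt, hdrop]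
      have hset : ((Finset.range (m + 1 + K + 1)).filter fun p =>
            p + w.length ≤ m + 1 + K ∧ factorAt x (i + p) w.length = w) =
          ((Finset.range (m + K + 1)).filter fun p =>
            p + w.length ≤ m + K ∧ factorAt x (i + p) w.length = w) ∪
          (({m + (K + 1 - w.length)} : Finset ℕ).filter fun p =>
            factorAt x (i + p) w.length = w) := by
        ext p
        simp only [Finset.mem_filter, Finset.mem_range, Finset.mem_union, Finset.mem_singleton]
        constructor
        · rintro ⟨-, h, hw'⟩
          by_cases hp : p + w.length ≤ m + K
          · exact Or.inl ⟨by omega, hp, hw'⟩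
          · exact Or.inr ⟨by omega, hw'⟩
        · rintro (⟨-, h, hw'⟩ | ⟨h, hw'⟩)
          · exact ⟨by omega, by omega, hw'⟩
          · exact ⟨by omega, by omega, hw'⟩
      rw [hset, Finset.card_union_of_disjoint, Finset.filter_singleton]
      · split_ifs <;> simp
      · rw [Finset.disjoint_left]
        intro p hp hp'
        simp only [Finset.mem_filter, Finset.mem_singleton] at hp hp'
        omega
    rw [hsplit, ih, Finset.range_add_one, Finset.filter_insert]
    split_ifs <;> simp [add_assoc]

/-- Two windows of length `m + K` are `(K + 1)`-abelian equivalent if and only if they contain the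
same blocks of length `K + 1` equally often and their prefixes of length `K` are `K`-abelian
equivalent. -/
theorem kAbelianEquiv_factorAt_add_iff (x : ℕ → A) (K : ℕ) (θ : factors x (K + 1) ≃ C) [Finite C]
    (i j m : ℕ) : KAbelianEquiv (K + 1) (factorAt x i (m + K)) (factorAt x j (m + K)) ↔
      (∀ c, windowCount (slidingBlockCode x (K + 1) θ) c i m =
        windowCount (slidingBlockCode x (K + 1) θ) c j m) ∧
      KAbelianEquiv K (factorAt x i K) (factorAt x j K) := by
  classical
  have := Fintype.ofFinite C
  have hcode : ∀ i, ((θ.symm (slidingBlockCode x (K + 1) θ i) : factors x (K + 1)) : List A) =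
      factorAt x i (K + 1) := fun i => by rw [slidingBlockCode, Equiv.symm_apply_apply]
  -- Words of length `K + 1` do not occur in the prefix of length `K`.
  have hlong : ∀ (w : List A) (i : ℕ), w.length = K + 1 →
      occurrences w (factorAt x i K) = 0 := by
    intro w i hw
    rw [occurrences_factorAt, Finset.card_eq_zero, Finset.filter_eq_empty_iff]
    intro p _ h
    omega
  have hblock_sum : ∀ (w : List A) (i : ℕ), ((Finset.range m).filter fun p =>
      (factorAt x (i + p) (K + 1)).drop (K + 1 - w.length) = w).card =
        ∑ c ∈ Finset.univ.filter fun c =>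
            ((θ.symm c : factors x (K + 1)) : List A).drop (K + 1 - w.length) = w,
          windowCount (slidingBlockCode x (K + 1) θ) c i m := by
    intro w i
    rw [Finset.card_eq_sum_card_fiberwise (f := fun p => slidingBlockCode x (K + 1) θ (i + p))]
    · refine Finset.sum_congr rfl fun c hc => ?_
      rw [windowCount, Finset.filter_filter]
      congr 1
      refine Finset.filter_congr fun p _ => and_iff_right_of_imp ?_
      rintro rfl
      rw [← hcode]
      exact (Finset.mem_filter.1 hc).2
    · intro p hp
      simpa [hcode] using (Finset.mem_filter.1 hp).2
  have hblock : (∀ c, windowCount (slidingBlockCode x (K + 1) θ) c i m =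
      windowCount (slidingBlockCode x (K + 1) θ) c j m) → ∀ w : List A,
      ((Finset.range m).filter fun p =>
        (factorAt x (i + p) (K + 1)).drop (K + 1 - w.length) = w).card =
      ((Finset.range m).filter fun p =>
        (factorAt x (j + p) (K + 1)).drop (K + 1 - w.length) = w).card := by
    intro h w
    rw [hblock_sum, hblock_sum]
    exact Finset.sum_congr rfl fun c _ => h c
  constructor
  · intro h
    have hcount : ∀ c, windowCount (slidingBlockCode x (K + 1) θ) c i m =
        windowCount (slidingBlockCode x (K + 1) θ) c j m := by
      intro c
      have hlen : ((θ.symm c : factors x (K + 1)) : List A).length = K + 1 := by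
        obtain ⟨l, hl⟩ := (θ.symm c).2
        rw [hl, length_factorAt]
      have hc := h _ hlen.le
      rw [occurrences_factorAt_add x hlen.le, occurrences_factorAt_add x hlen.le, hlong _ _ hlen,
        hlong _ _ hlen, hlen] at hc
      have hiff : ∀ p, factorAt x p (K + 1) = ((θ.symm c : factors x (K + 1)) : List A) ↔
          slidingBlockCode x (K + 1) θ p = c := by
        intro p
        rw [← hcode, Subtype.coe_inj, Equiv.apply_eq_iff_eq]
      simpa [hiff, windowCount] using hc
    refine ⟨hcount, fun w hw => ?_⟩
    have h₁ := h w (by omega)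
    have h₂ := hblock hcount w
    rw [occurrences_factorAt_add x (by omega), occurrences_factorAt_add x (by omega)] at h₁
    omega
  · rintro ⟨hcount, h⟩ w hw
    rw [occurrences_factorAt_add x hw, occurrences_factorAt_add x hw, hblock hcount w]
    rcases hw.lt_or_eq with hlt | heq
    · rw [h w (by omega)]
    · rw [hlong w i heq, hlong w j heq]

end Occurrences

/-! ### Recognizability of `k`-abelian equivalence -/

namespace NumerationSystem

variable {D : Type*} [LinearOrder D] [OrderBot D] {N : NumerationSystem D} {ι C : Type*}

theorem IsAutomatic.finite_range {y : ℕ → C} [Finite D] (hy : N.IsAutomatic y) :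
    (Set.range y).Finite := by
  obtain ⟨σ, _, M, hM⟩ := hy
  refine Set.Finite.of_finite_image (f := some) ((Set.finite_range M.output).subset ?_)
    (Option.some_injective C).injOn
  rintro _ ⟨_, ⟨n, rfl⟩, rfl⟩
  have h := (hM (N.rep n)).1 (N.rep_mem_language n)
  rw [val_rep] at h
  exact ⟨_, h⟩

theorem IsAutomatic.recognizable [Finite ι] (hN : N.IsRegular) {y : ℕ → C}
    (hy : N.IsAutomatic y) (c : C) (i : ι) : N.Recognizable fun a : ι → ℕ => y (a i) = c := by
  obtain ⟨σ, _, M, hM⟩ := hy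
  have := Fintype.ofFinite σ
  have hreg : Language.IsRegular ({u | M.eval u = some c} : Language D) :=
    ⟨σ, inferInstance, ⟨M.step, M.start, {s | M.output s = some c}⟩, rfl⟩
  refine (Language.IsRegular.and (hN.recognizable_true (ι := ι))
    (hreg.comap fun d => d i)).of_mem_iff fun w => ?_
  change _ ∧ _ = c ↔ (_ ∧ True) ∧ M.eval _ = some c
  rw [and_true]
  exact and_congr_right fun hw => by rw [(hM _).1 (hw i), Option.some_inj]

theorem IsAutomatic.recognizable_rel [Finite ι] [Finite C] (hN : N.IsRegular) {y : ℕ → C}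
    (hy : N.IsAutomatic y) (Q : C → C → Prop) (i j : ι) :
    N.Recognizable fun a : ι → ℕ => Q (y (a i)) (y (a j)) := by
  refine (Recognizable.exists_finite (κ := C × C) hN fun c =>
    (hN.recognizable_const (Q c.1 c.2)).and
      ((hy.recognizable hN c.1 i).and (hy.recognizable hN c.2 j))).of_iff fun a => ?_
  constructor
  · intro h
    exact ⟨(y (a i), y (a j)), h, rfl, rfl⟩
  · rintro ⟨c, h, h₁, h₂⟩
    rwa [h₁, h₂]

theorem IsSynchronized.recognizableFun [Finite D] [Finite ι] [Finite C] (hN : N.IsRegular)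
    {s : ℕ → C → ℕ} (hs : N.IsSynchronized s) (c : C) {F : (ι → ℕ) → ℕ}
    (hF : N.RecognizableFun F) : N.RecognizableFun fun a => s (F a) c := by
  have hrel : N.Recognizable fun a : Option C → ℕ => ∀ c, s (a none) c = a (some c) := by
    refine (Language.IsRegular.comap hs fun d : Option C → D =>
      (d none, fun c => d (some c))).of_mem_iff fun w => ?_
    change (∀ i, _) ∧ _ ↔ _ ∧ (∀ i, _ ∈ _) ∧ _
    simp only [List.map_map, Function.comp_def, Option.forall]
    exact and_assoc
  have hgraph : N.Recognizable fun a : Fin 2 → ℕ => a 0 = s (a 1) c := by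
    refine (Recognizable.exists (κ := C)
      (R := fun (a : Fin 2 → ℕ) b => (∀ c, s (a 1) c = b c) ∧ b c = a 0)
      ((hrel.comap hN fun o : Option C => o.elim (Sum.inl 1) Sum.inr).and
        (hN.recognizable_eq_var _ _))).of_iff fun a => ?_
    constructor
    · intro h
      exact ⟨s (a 1), fun _ => rfl, h.symm⟩
    · rintro ⟨b, hb, hc⟩
      rw [hb, hc]
  exact hgraph.subst hN (F := ![fun a : Option ι → ℕ => a none, fun a => F fun i => a (some i)])
    (by
      rw [Fin.forall_fin_two]
      exact ⟨hN.recognizableFun_var none, hF.comap hN some⟩)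

/-- For windows of length at least `k - 1`, equivalence is expressed by prefix Parikh vectors and
the letters of the block code at the two positions; for the finitely many smaller lengths, these
letters suffice. -/
theorem recognizable_kAbelianEquiv_factorAt [Finite D] (hN : N.IsRegular) {A : Type*} [Finite C]
    (x : ℕ → A) (K : ℕ) (θ : factors x (K + 1) ≃ C)
    (hauto : N.IsAutomatic (slidingBlockCode x (K + 1) θ))
    (hsync : N.IsSynchronized (prefixParikh (slidingBlockCode x (K + 1) θ))) :
    N.Recognizable fun a : Fin 3 → ℕ =>
      KAbelianEquiv (K + 1) (factorAt x (a 1) (a 0)) (factorAt x (a 2) (a 0)) := by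
  set y := slidingBlockCode x (K + 1) θ with hy
  have hcode : ∀ i n, n ≤ K + 1 →
      ((θ.symm (y i) : factors x (K + 1)) : List A).take n = factorAt x i n := by
    intro i n hn
    rw [hy, slidingBlockCode, Equiv.symm_apply_apply]
    simpa using take_drop_factorAt x (i := i) (p := 0) (l := n) (n := K + 1) (by omega)
  let Q (l n : ℕ) (c c' : C) : Prop :=
    KAbelianEquiv l (((θ.symm c : factors x (K + 1)) : List A).take n)
      (((θ.symm c' : factors x (K + 1)) : List A).take n)
  have hlong : N.Recognizable fun a : Fin 3 → ℕ => ∃ m, (m + K = a 0 ∧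
      ∀ c, prefixParikh y (a 1 + m) c + prefixParikh y (a 2) c =
        prefixParikh y (a 2 + m) c + prefixParikh y (a 1) c) ∧ Q K K (y (a 1)) (y (a 2)) := by
    refine Recognizable.exists_nat hN (ι := Fin 3) (R := fun a m => (m + K = a 0 ∧
      ∀ c, prefixParikh y (a 1 + m) c + prefixParikh y (a 2) c =
        prefixParikh y (a 2 + m) c + prefixParikh y (a 1) c) ∧ Q K K (y (a 1)) (y (a 2))) ?_
    have hv : ∀ i : Option (Fin 3), N.RecognizableFun fun a : Option (Fin 3) → ℕ => a i :=
      fun i => hN.recognizableFun_var i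
    refine (Recognizable.and ?_ (Recognizable.forall_finite hN fun c => ?_)).and
      (hauto.recognizable_rel hN _ _ _)
    · exact ((hv none).add hN (hN.recognizableFun_const K)).eq hN (hv (some 0))
    · exact ((hsync.recognizableFun hN c ((hv (some 1)).add hN (hv none))).add hN
        (hsync.recognizableFun hN c (hv (some 2)))).eq hN
        ((hsync.recognizableFun hN c ((hv (some 2)).add hN (hv none))).add hN
        (hsync.recognizableFun hN c (hv (some 1))))
  have hshort : N.Recognizable fun a : Fin 3 → ℕ => ∃ n : Fin K, a 0 = n ∧
      Q (K + 1) n (y (a 1)) (y (a 2)) :=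
    Recognizable.exists_finite hN fun n =>
      ((hN.recognizableFun_var 0).eq hN (hN.recognizableFun_const n)).and
        (hauto.recognizable_rel hN _ _ _)
  refine (hlong.or hN hshort).of_iff fun a => ?_
  have hQlong : ∀ m, ((∀ c, prefixParikh y (a 1 + m) c + prefixParikh y (a 2) c =
      prefixParikh y (a 2 + m) c + prefixParikh y (a 1) c) ∧ Q K K (y (a 1)) (y (a 2))) ↔
      KAbelianEquiv (K + 1) (factorAt x (a 1) (m + K)) (factorAt x (a 2) (m + K)) := by
    intro m
    rw [kAbelianEquiv_factorAt_add_iff x K θ, ← hy]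
    simp only [Q, hcode _ K (Nat.le_succ K), prefixParikh_add]
    refine and_congr_left fun _ => forall_congr' fun c => ?_
    omega
  constructor
  · intro h
    rcases lt_or_ge (a 0) K with hlt | hge
    · refine Or.inr ⟨⟨a 0, hlt⟩, rfl, ?_⟩
      simp only [Q]
      rwa [hcode _ _ (by omega), hcode _ _ (by omega)]
    · obtain ⟨m, hm⟩ := Nat.exists_eq_add_of_le' hge
      rw [hm, ← hQlong] at h
      exact Or.inl ⟨m, ⟨hm.symm, h.1⟩, h.2⟩
  · rintro (⟨m, ⟨hm, h⟩, hQ⟩ | ⟨n, hn, hQ⟩)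
    · rw [← hm]
      exact (hQlong m).1 ⟨h, hQ⟩
    · have := n.2
      simp only [Q] at hQ
      rwa [hcode _ _ (by omega), hcode _ _ (by omega), ← hn] at hQ

end NumerationSystem

/-! ### Counting the equivalence classes -/

theorem finite_factors {A : Type*} {x : ℕ → A} (hx : (Set.range x).Finite) (n : ℕ) :
    (factors x n).Finite := by
  have := hx.to_subtype
  refine (Set.finite_range fun f : Fin n → Set.range x =>
    List.ofFn fun j => (f j : A)).subset ?_
  rintro _ ⟨i, rfl⟩
  exact ⟨fun j => ⟨x (i + j), i + j, rfl⟩, List.ext_getElem (by simp [factorAt])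
    (by simp [factorAt])⟩

/-- Every class is counted at the first position where a word of the class occurs. -/
theorem bijective_firstOccurrence {A : Type*} (x : ℕ → A) (k n : ℕ) :
    Function.Bijective fun i : {i | ¬ ∃ j, j < i ∧
        KAbelianEquiv k (factorAt x i n) (factorAt x j n)} =>
      (Quotient.mk (kAbelianSetoid x k n) ⟨factorAt x i n, i, rfl⟩) := by
  constructor
  · rintro ⟨i, hi⟩ ⟨j, hj⟩ h
    have hij : KAbelianEquiv k (factorAt x i n) (factorAt x j n) := Quotient.exact h
    rcases lt_trichotomy i j with hlt | heq | hgt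
    · exact absurd ⟨i, hlt, fun w hw => (hij w hw).symm⟩ hj
    · exact Subtype.ext heq
    · exact absurd ⟨j, hgt, hij⟩ hi
  · intro q
    obtain ⟨⟨_, i, rfl⟩, rfl⟩ := Quotient.exists_rep q
    classical
    have hex : ∃ j, KAbelianEquiv k (factorAt x j n) (factorAt x i n) := ⟨i, fun _ _ => rfl⟩
    refine ⟨⟨Nat.find hex, ?_⟩, Quotient.sound (Nat.find_spec hex)⟩
    rintro ⟨j, hj, h⟩
    exact Nat.find_min hex hj fun w hw => (h w hw).symm.trans (Nat.find_spec hex w hw)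

theorem mainTheorem4 {D : Type*} [LinearOrder D] [OrderBot D] [Finite D]
    (N : NumerationSystem D) (hN : N.IsRegular)
    {A C : Type*} (k : ℕ) (hk : 1 ≤ k) (x : ℕ → A) (θ : factors x k ≃ C)
    (hauto : N.IsAutomatic (slidingBlockCode x k θ))
    (hsync : N.IsSynchronized (prefixParikh (slidingBlockCode x k θ))) :
    N.IsRegularSequence (fun n => (kAbelianComplexity x k n : ℂ)) := by
  obtain ⟨K, rfl⟩ := Nat.exists_eq_add_of_le' hk
  have hfactors : (factors x (K + 1)).Finite := by
    have h := hauto.finite_range.image fun c => ((θ.symm c : factors x (K + 1)) : List A)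
    refine h.subset ?_
    rintro _ ⟨i, rfl⟩
    exact ⟨_, ⟨i, rfl⟩, by simp [slidingBlockCode]⟩
  have := hfactors.to_subtype
  have : Finite C := .of_equiv _ θ
  have hrange : (Set.range x).Finite := by
    refine Set.Finite.of_finite_image (f := some)
      ((hfactors.image List.head?).subset ?_) (Option.some_injective A).injOn
    rintro _ ⟨_, ⟨i, rfl⟩, rfl⟩
    exact ⟨factorAt x i (K + 1), ⟨i, rfl⟩, by simp [factorAt, List.range_succ_eq_map]⟩
  have hrec := NumerationSystem.recognizable_kAbelianEquiv_factorAt hN x K θ hauto hsync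
  let R (a : Fin 2 → ℕ) : Prop := ¬ ∃ j, j < a 1 ∧
    KAbelianEquiv (K + 1) (factorAt x (a 1) (a 0)) (factorAt x j (a 0))
  have hR : N.Recognizable R := by
    refine (NumerationSystem.Recognizable.exists_nat hN (ι := Fin 2) (R := fun a j => j < a 1 ∧
      KAbelianEquiv (K + 1) (factorAt x (a 1) (a 0)) (factorAt x j (a 0))) ?_).not hN
    exact ((hN.recognizableFun_var none).lt hN (hN.recognizableFun_var (some 1))).and
      (hrec.comap hN ![some 0, some 1, none])
  have e (n : ℕ) : {i | R ![n, i]} ≃ Quotient (kAbelianSetoid x (K + 1) n) :=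
    Equiv.ofBijective _ (bijective_firstOccurrence x (K + 1) n)
  have hfin : ∀ n, {i | R ![n, i]}.Finite := by
    intro n
    have := (finite_factors hrange n).to_subtype
    have : Finite {i | R ![n, i]} := .of_equiv _ (e n).symm
    exact Set.toFinite _
  have hcount : ∀ n, kAbelianComplexity x (K + 1) n = {i | R ![n, i]}.ncard := fun n => by
    rw [kAbelianComplexity, ← Nat.card_congr (e n), Nat.card_coe_set_eq]
  simpa only [hcount] using hR.isRegularSequence_ncard hfin
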